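/- **Setting.** A multi-type language has a collection of types, and operational and structural connectives of finite arity; each coordinate of a connective has a type, and so has its result. Operational terms are built by the operational connectives (atomic terms are nullary connectives); structures are built from operational terms by structural connectives. Every term has exactly one type. Each coordinate of a structural connective has a polarity. A sequent $x\vdash y$ is a pair of structures; it is *type-uniform* if $x$ and $y$ have the same type. The left (right) side of a sequent is in precedent (succedent) position, and the position of a substructure changes at each negative coordinate on the path to it; a substructure is *in display* if it is one of the two sides. A multi-type calculus consists of a set of rules, each a set of inferences with finitely many premises, and of cut rules, with applications of the form $x\vdash a,\ a\vdash y\,/\,x\vdash y$ where $a$ is an operational term; for each type $T$ all cuts with $x,a,y$ of type $T$ are allowed. Every application of a rule other than cut comes with an analysis: a set of occurrences of substructures in it, its *parameters*, and an equivalence relation on them, *congruence*. An operational term that occurs non-parametrically in the conclusion is *principal*. An *axiom* is the conclusion of a rule application without premises. Derivable means derivable with cut allowed. The calculus is a *display calculus* if some of its one-premise rules are designated as display rules such that the inverse of an application of a display rule, with the same congruence, is an application of a display rule, and such that for each derivable sequent and each occurrence of a substructure in it, a finite sequence of applications of display rules transforms the sequent into one in which that occurrence, traced along congruence, is in display. **Theorem.**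 Suppose that a multi-type display calculus satisfies the following conditions. - $C_2$: congruent parameters are occurrences of the same structure. - $C'_2$: congruent parameters have the same type. - $C'_3$: in each inference, each parameter is congruent to at most one constituent of the conclusion. This need not hold for parameters of a type $T$ such that whenever $x\vdash a$ and $a\vdash y$ are derivable and are the premises of an application of cut with $a$ of type $T$, then $x=a$ or $y=a$. - $C_4$: congruent parameters are all in precedent position or all in succedent position. - $C'_5$: if an operational term is principal in the last inference of a derivation, then it is in display, unless the derivation consists of an axiom only. - In an axiom, each operational term has at most one principal occurrence in precedent position and at most one in succedent position. - $C''_5$: the result of applying a display rule to an axiom is an axiom. - $C'_6$ (resp. $C'_7$): each rule is closed under simultaneous substitution of arbitrary structures for congruent parametric occurrences of operational terms in succedent (resp. precedent) position. Here a structure has the same type as the term it replaces, congruent occurrences are replaced by the same structure, several congruence classes may be replaced at once, and principal terms of the given inference are still principal in the resulting application of the rule. - $C'_8$: if $x\vdash a$ and $a\vdash y$ are the conclusions of two rule applications with derivable premises, with the displayed $a$ principal in both, and cut applies to them, then $x\vdash y$ has a derivation from the premises of these two rule applications in which every cut is on a proper subterm of $a$ and is strongly type-uniform. - $C''_8$: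 if $x\vdash a$ and $a\vdash y$ are axioms, then so is $x\vdash y$. - $C_9$: every derivable sequent is type-uniform. - $C_{10}$: every application $x\vdash a,\ a\vdash y\,/\,x\vdash y$ of a cut rule is strongly type-uniform, i.e. $x$, $a$, $y$ have the same type. Then the calculus is cut-admissible: every derivable sequent has a cut-free derivation. If moreover - $C_1$: in each application of a rule other than cut, each operational term that occurs in a premise is a subterm of an operational term that occurs in the conclusion, then the calculus has the subformula property: every derivable sequent $s$ has a cut-free derivation in which each operational term that occurs is a subterm of an operational term that occurs in $s$. -/

import Mathlib

universe u

namespace MultiType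

/-! ### Multi-type languages -/

/-- A multi-type language: a collection of types, and operational and structural connectives, each
with an arity, a type for each coordinate and a result type (so a connective may be internal to one
type or may relate different types).  Atomic terms are the nullary operational connectives.  Each
coordinate of a structural connective has a polarity: `strNeg c i` says that it is negative. -/
structure Language where
  Ty : Type u
  OpConn : Type u
  opArity : OpConn → ℕ
  opDom : (c : OpConn) → Fin (opArity c) → Ty
  opCod : OpConn → Ty
  StrConn : Type u
  strArity : StrConn → ℕ
  strDom : (c : StrConn) → Fin (strArity c) → Ty
  strCod : StrConn → Ty
  strNeg : (c : StrConn) → Fin (strArity c) → Bool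

variable {L : Language.{u}}

/-- Operational terms. -/
inductive Op (L : Language.{u}) : Type u
  | app (c : L.OpConn) (args : Fin (L.opArity c) → Op L) : Op L

/-- The type of an operational term. -/
def Op.type : Op L → L.Ty
  | .app c _ => L.opCod c

/-- An operational term is well formed if every argument has the type that its coordinate asks. -/
def Op.WF : Op L → Prop
  | .app c args => ∀ i, (args i).type = L.opDom c i ∧ (args i).WF

/-- `a.IsSubterm b`: `a` is a (not necessarily proper) subterm of `b`. -/
inductive Op.IsSubterm : Op L → Op L → Prop
  | refl (a : Op L) : Op.IsSubterm a a
  | arg {a : Op L} (c : L.OpConn) (args : Fin (L.opArity c) → Op L) (i : Fin (L.opArity c)) :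
      Op.IsSubterm a (args i) → Op.IsSubterm a (.app c args)

def Op.IsProperSubterm (a b : Op L) : Prop := a.IsSubterm b ∧ a ≠ b

/-- Structural terms (structures): built from operational terms by structural connectives. -/
inductive Str (L : Language.{u}) : Type u
  | op (a : Op L) : Str L
  | node (c : L.StrConn) (args : Fin (L.strArity c) → Str L) : Str L

/-- The type of a structure. -/
def Str.type : Str L → L.Ty
  | .op a => a.type
  | .node c _ => L.strCod c

def Str.WF : Str L → Prop
  | .op a => a.WF
  | .node c args => ∀ i, (args i).type = L.strDom c i ∧ (args i).WF

/-- The two kinds of parts of a sequent. -/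
inductive Position
  | precedent
  | succedent

def Position.flip : Position → Position
  | .precedent => .succedent
  | .succedent => .precedent

/-- The substructure at the node of the generation tree reached by a path, if there is one. -/
def Str.sub : Str L → List ℕ → Option (Str L)
  | x, [] => some x
  | .op _, _ :: _ => none
  | .node c args, i :: p => if h : i < L.strArity c then (args ⟨i, h⟩).sub p else none

/-- The position of the node reached by a path, when the root has position `q`: it changes at every
negative coordinate on the path. -/
def Str.position : Str L → List ℕ → Position → Position
  | _, [], q => q
  | .op _, _ :: _, q => q
  | .node c args, i :: p, q =>
      if h : i < L.strArity c then
        (args ⟨i, h⟩).position p (if L.strNeg c ⟨i, h⟩ then q.flip else q)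
      else q

/-- Simultaneous replacement: the node at path `p` is replaced by `z` whenever `σ p = some z`. -/
def Str.replace : (List ℕ → Option (Str L)) → Str L → Str L
  | σ, .op a => (σ []).getD (.op a)
  | σ, .node c args =>
      (σ []).getD (.node c fun i => (args i).replace fun p => σ (i.val :: p))

/-! ### Sequents and occurrences -/

/-- A sequent `left ⊢ right`; the two sides may have different types. -/
structure Sequent (L : Language.{u}) where
  left : Str L
  right : Str L

inductive Side
  | left
  | right

/-- A place in a sequent: a side and a path in the generation tree of that side. -/
structure Place where
  side : Side
  path : List ℕ

namespace Sequent

def WF (s : Sequent L) : Prop := s.left.WF ∧ s.right.WF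

/-- The two sides have the same type. -/
def TypeUniform (s : Sequent L) : Prop := s.left.type = s.right.type

/-- The substructure that occurs at a place. -/
def sub (s : Sequent L) : Place → Option (Str L)
  | ⟨.left, p⟩ => s.left.sub p
  | ⟨.right, p⟩ => s.right.sub p

/-- Whether a place is an antecedent (precedent) or a succedent part of the sequent. -/
def position (s : Sequent L) : Place → Position
  | ⟨.left, p⟩ => s.left.position p .precedent
  | ⟨.right, p⟩ => s.right.position p .succedent

def replace (σ : Place → Option (Str L)) (s : Sequent L) : Sequent L where
  left := s.left.replace fun p => σ ⟨.left, p⟩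
  right := s.right.replace fun p => σ ⟨.right, p⟩

/-- The operational term `a` occurs in `s` (as a leaf of the generation tree of one side). -/
def OccursIn (a : Op L) (s : Sequent L) : Prop := ∃ o, s.sub o = some (.op a)

end Sequent

/-! ### Inferences and their analysis -/

/-- An inference with `n` premises. -/
structure Inference (L : Language.{u}) (n : ℕ) where
  prem : Fin n → Sequent L
  concl : Sequent L

/-- A place in an inference: in the conclusion (`none`) or in the `i`-th premise (`some i`). -/
abbrev InfPlace (n : ℕ) := Option (Fin n) × Place

namespace Inference

variable {n : ℕ}

def seq (I : Inference L n) : Option (Fin n) → Sequent L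
  | none => I.concl
  | some i => I.prem i

def sub (I : Inference L n) (o : InfPlace n) : Option (Str L) := (I.seq o.1).sub o.2

def position (I : Inference L n) (o : InfPlace n) : Position := (I.seq o.1).position o.2

/-- Simultaneous replacement in all premises and the conclusion. -/
def replace (σ : InfPlace n → Option (Str L)) (I : Inference L n) : Inference L n where
  prem i := (I.prem i).replace fun o => σ (some i, o)
  concl := I.concl.replace fun o => σ (none, o)

/-- The inference of the premise from the conclusion, for a one-premise inference. -/
def inv (I : Inference L 1) : Inference L 1 where
  prem _ := I.concl
  concl := I.prem 0

end Inference

/-- The analysis of an inference specifies which constituents are parameters, and the congruence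
relation, an equivalence relation on the parameters.  It is given as a symmetric and transitive
relation; the parameters are the places that it relates to themselves. -/
structure Analysis (n : ℕ) where
  Congr : InfPlace n → InfPlace n → Prop
  symm : ∀ {o o'}, Congr o o' → Congr o' o
  trans : ∀ {o o' o''}, Congr o o' → Congr o' o'' → Congr o o''

def Analysis.IsParam {n : ℕ} (A : Analysis n) (o : InfPlace n) : Prop := A.Congr o o

/-- Exchange of the premise and the conclusion of a one-premise inference. -/
def InfPlace.swap : InfPlace 1 → InfPlace 1
  | (none, o) => (some 0, o)
  | (some _, o) => (none, o)

def Analysis.inv (A : Analysis 1) : Analysis 1 where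
  Congr o o' := A.Congr (InfPlace.swap o) (InfPlace.swap o')
  symm h := A.symm h
  trans h h' := A.trans h h'

/-- The conclusion of the inference `I`, analysed by `A`, has the operational term `a` as a principal
(that is, non-parametric) constituent at the place `o`. -/
def PrincipalAt {n : ℕ} (I : Inference L n) (A : Analysis n) (o : Place) (a : Op L) : Prop :=
  I.concl.sub o = some (.op a) ∧ ¬ A.IsParam (none, o)

/-! ### Multi-type calculi -/

/-- A multi-type sequent calculus.  `app r I A` says that the inference `I`, analysed by `A`, is an
application of the rule `r`; `IsDisplay` singles out the display rules; `Cut x a y` says that the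
inference of `x ⊢ y` from `x ⊢ a` and `a ⊢ y` is an application of one of the cut rules, which are
kept apart from the other rules.  There is a cut rule for each type. -/
structure Calculus (L : Language.{u}) where
  Rule : Type u
  app : Rule → {n : ℕ} → Inference L n → Analysis n → Prop
  IsDisplay : Rule → Prop
  Cut : Str L → Op L → Str L → Prop
  app_wf : ∀ {r : Rule} {n : ℕ} {I : Inference L n} {A : Analysis n}, app r I A → ∀ k, (I.seq k).WF
  app_param : ∀ {r : Rule} {n : ℕ} {I : Inference L n} {A : Analysis n}, app r I A →
    ∀ o, A.IsParam o → ∃ z, I.sub o = some z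
  cut_wf : ∀ {x a y}, Cut x a y → x.WF ∧ a.WF ∧ y.WF
  cut_of_type : ∀ {x : Str L} {a : Op L} {y : Str L}, x.WF → a.WF → y.WF →
    x.type = a.type → y.type = a.type → Cut x a y

/-- Derivations from a set `H` of assumptions. -/
inductive Derivation (C : Calculus L) (H : Set (Sequent L)) : Sequent L → Type u
  | hyp {s : Sequent L} (h : s ∈ H) : Derivation C H s
  | rule {r : C.Rule} {n : ℕ} {I : Inference L n} {A : Analysis n} (h : C.app r I A)
      (d : ∀ i, Derivation C H (I.prem i)) : Derivation C H I.concl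
  | cut {x : Str L} {a : Op L} {y : Str L} (h : C.Cut x a y)
      (d₁ : Derivation C H ⟨x, .op a⟩) (d₂ : Derivation C H ⟨.op a, y⟩) : Derivation C H ⟨x, y⟩

namespace Derivation

variable {C : Calculus L} {H : Set (Sequent L)}

/-- Every application of cut in the derivation satisfies `P`. -/
def AllCuts (P : Str L → Op L → Str L → Prop) : {s : Sequent L} → Derivation C H s → Prop
  | _, .hyp _ => True
  | _, .rule _ d => ∀ i, (d i).AllCuts P
  | _, .cut (x := x) (a := a) (y := y) _ d₁ d₂ => P x a y ∧ d₁.AllCuts P ∧ d₂.AllCuts P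

/-- Cut is not used in the derivation. -/
def CutFree {s : Sequent L} (d : Derivation C H s) : Prop := d.AllCuts fun _ _ _ => False

/-- The sequent `t` occurs in the derivation. -/
def Contains (t : Sequent L) : {s : Sequent L} → Derivation C H s → Prop
  | s, .hyp _ => t = s
  | _, .rule (I := I) _ d => t = I.concl ∨ ∃ i, (d i).Contains t
  | _, .cut (x := x) (y := y) _ d₁ d₂ => t = ⟨x, y⟩ ∨ d₁.Contains t ∨ d₂.Contains t

end Derivation

namespace Calculus

variable (C : Calculus L)

/-- The sequent is derivable (cut being available). -/
def Derivable (s : Sequent L) : Prop := Nonempty (Derivation C ∅ s)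

/-- An axiom: the conclusion of a rule application without premises. -/
def IsAxiom (s : Sequent L) : Prop :=
  ∃ (r : C.Rule) (I : Inference L 0) (A : Analysis 0), C.app r I A ∧ I.concl = s

/-! ### Display calculi -/

/-- One application of a display rule, leading from a sequent to another one and taking the
constituent at a place of the first to a congruent constituent of the second. -/
def DisplayStep (t t' : Sequent L × Place) : Prop :=
  ∃ (r : C.Rule) (I : Inference L 1) (A : Analysis 1), C.IsDisplay r ∧ C.app r I A ∧
    I.prem 0 = t.1 ∧ I.concl = t'.1 ∧ A.Congr (some 0, t.2) (none, t'.2)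

/-- A display calculus: display rules are one-premise rules and can be applied in both directions,
and every substructure of every derivable sequent can be displayed, i.e. turned into one of the two
sides by means of display rules (the relativized display property). -/
structure IsDisplayCalculus : Prop where
  unary : ∀ (r : C.Rule) (n : ℕ) (I : Inference L n) (A : Analysis n),
    C.IsDisplay r → C.app r I A → n = 1
  invertible : ∀ (r : C.Rule) (I : Inference L 1) (A : Analysis 1), C.IsDisplay r → C.app r I A →
    ∃ r', C.IsDisplay r' ∧ C.app r' I.inv A.inv
  display : ∀ (s : Sequent L) (o : Place) (z : Str L), C.Derivable s → s.sub o = some z →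
    ∃ (s' : Sequent L) (o' : Place),
      Relation.ReflTransGen C.DisplayStep (s, o) (s', o') ∧ o'.path = []

/-! ### The conditions -/

/-- Preservation of operational terms. -/
def C1 : Prop :=
  ∀ (r : C.Rule) (n : ℕ) (I : Inference L n) (A : Analysis n), C.app r I A →
    ∀ (i : Fin n) (a : Op L), Sequent.OccursIn a (I.prem i) →
      ∃ b, Sequent.OccursIn b I.concl ∧ a.IsSubterm b

/-- Shape-alikeness of parameters. -/
def C2 : Prop :=
  ∀ (r : C.Rule) (n : ℕ) (I : Inference L n) (A : Analysis n), C.app r I A →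
    ∀ o o', A.Congr o o' → I.sub o = I.sub o'

/-- Type-alikeness of parameters. -/
def C2' : Prop :=
  ∀ (r : C.Rule) (n : ℕ) (I : Inference L n) (A : Analysis n), C.app r I A →
    ∀ o o' z z', A.Congr o o' → I.sub o = some z → I.sub o' = some z' → z.type = z'.type

/-- All applications of cut with a cut term of type `T` to derivable premises have the shape
`x ⊢ a, a ⊢ a / x ⊢ a` or the shape `a ⊢ a, a ⊢ y / a ⊢ y`. -/
def OnlyTrivialCuts (T : L.Ty) : Prop :=
  ∀ (x : Str L) (a : Op L) (y : Str L), a.type = T → C.Cut x a y →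
    C.Derivable ⟨x, .op a⟩ → C.Derivable ⟨.op a, y⟩ → x = .op a ∨ y = .op a

/-- Restricted non-proliferation of parameters. -/
def C3' : Prop :=
  ∀ (r : C.Rule) (n : ℕ) (I : Inference L n) (A : Analysis n), C.app r I A →
    ∀ (o : InfPlace n) (z : Str L), I.sub o = some z → ¬ C.OnlyTrivialCuts z.type →
      ∀ o₁ o₂ : Place, A.Congr o (none, o₁) → A.Congr o (none, o₂) → o₁ = o₂

/-- Position-alikeness of parameters. -/
def C4 : Prop :=
  ∀ (r : C.Rule) (n : ℕ) (I : Inference L n) (A : Analysis n), C.app r I A →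
    ∀ o o', A.Congr o o' → I.position o = I.position o'

/-- Quasi-display of principal constituents: an operational term that is principal in the conclusion
of a derivation is in display, unless the derivation consists of an axiom only. -/
def C5' : Prop :=
  ∀ (r : C.Rule) (n : ℕ) (I : Inference L n) (A : Analysis n), C.app r I A →
    (∀ i, C.Derivable (I.prem i)) →
      ∀ (o : Place) (a : Op L), PrincipalAt I A o a → o.path = [] ∨ n = 0

/-- In an axiom, an operational term has at most one principal occurrence in precedent position and
at most one in succedent position. -/
def AxiomPrincipalUnique : Prop :=
  ∀ (r : C.Rule) (I : Inference L 0) (A : Analysis 0), C.app r I A →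
    ∀ (o₁ o₂ : Place) (a : Op L), PrincipalAt I A o₁ a → PrincipalAt I A o₂ a →
      I.concl.position o₁ = I.concl.position o₂ → o₁ = o₂

/-- Display-invariance of axioms. -/
def C5'' : Prop :=
  ∀ (r : C.Rule) (I : Inference L 1) (A : Analysis 1), C.IsDisplay r → C.app r I A →
    C.IsAxiom (I.prem 0) → C.IsAxiom I.concl

/-- Every rule is closed under simultaneous substitution, within each type, of arbitrary structures
for congruent operational terms in position `q`.  A substitution `σ` assigns to some parametric
occurrences of operational terms in position `q` structures of the same type, the same structure to
congruent occurrences.  The resulting inference has to be an application of the same rule, in which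
the principal constituents, which are not affected, are still principal. -/
def ClosedUnderSubst (q : Position) : Prop :=
  ∀ (r : C.Rule) (n : ℕ) (I : Inference L n) (A : Analysis n), C.app r I A →
    ∀ σ : InfPlace n → Option (Str L),
      (∀ o z, σ o = some z → ∃ a, I.sub o = some (.op a) ∧ A.IsParam o ∧ I.position o = q ∧
        z.WF ∧ z.type = a.type) →
      (∀ o o', A.Congr o o' → σ o = σ o') →
      ∃ A' : Analysis n, C.app r (I.replace σ) A' ∧
        ∀ (o : Place) (a : Op L), PrincipalAt I A o a → PrincipalAt (I.replace σ) A' o a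

/-- Closure under substitution for succedent parts within each type. -/
def C6' : Prop := C.ClosedUnderSubst .succedent

/-- Closure under substitution for precedent parts within each type. -/
def C7' : Prop := C.ClosedUnderSubst .precedent

/-- Eliminability of matching principal constituents: if the cut term `a` is principal in the last
inferences of the derivations of both premises of a cut, then the conclusion of the cut can be
derived from the premises of these two inferences, with cuts on proper subterms of `a` only, all of
which are strongly type-uniform. -/
def C8' : Prop :=
  ∀ (r₁ r₂ : C.Rule) (n₁ n₂ : ℕ) (I₁ : Inference L n₁) (I₂ : Inference L n₂)
    (A₁ : Analysis n₁) (A₂ : Analysis n₂) (x : Str L) (a : Op L) (y : Str L),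
    C.app r₁ I₁ A₁ → C.app r₂ I₂ A₂ →
    (∀ i, C.Derivable (I₁.prem i)) → (∀ i, C.Derivable (I₂.prem i)) →
    I₁.concl = ⟨x, .op a⟩ → I₂.concl = ⟨.op a, y⟩ →
    PrincipalAt I₁ A₁ ⟨.right, []⟩ a → PrincipalAt I₂ A₂ ⟨.left, []⟩ a →
    C.Cut x a y →
      ∃ d : Derivation C (Set.range I₁.prem ∪ Set.range I₂.prem) ⟨x, y⟩,
        d.AllCuts fun x' b y' =>
          b.IsProperSubterm a ∧ x'.type = b.type ∧ y'.type = b.type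

/-- Closure of axioms under cut. -/
def C8'' : Prop :=
  ∀ (x : Str L) (a : Op L) (y : Str L),
    C.IsAxiom ⟨x, .op a⟩ → C.IsAxiom ⟨.op a, y⟩ → C.IsAxiom ⟨x, y⟩

/-- Type-uniformity of derivable sequents. -/
def C9 : Prop := ∀ s : Sequent L, C.Derivable s → s.TypeUniform

/-- Strong type-uniformity of cut rules: the premises and the conclusion of every application of a
cut rule are sequents of one and the same type. -/
def C10 : Prop :=
  ∀ (x : Str L) (a : Op L) (y : Str L), C.Cut x a y → x.type = a.type ∧ y.type = a.type

/-! ### The conclusions -/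

/-- Every derivable sequent has a cut-free derivation. -/
def CutAdmissible : Prop :=
  ∀ s : Sequent L, C.Derivable s → ∃ d : Derivation C ∅ s, d.CutFree

/-- Every derivable sequent has a cut-free derivation in which every operational term that occurs is
a subterm of an operational term that occurs in the sequent. -/
def SubformulaProperty : Prop :=
  ∀ s : Sequent L, C.Derivable s → ∃ d : Derivation C ∅ s, d.CutFree ∧
    ∀ t : Sequent L, d.Contains t → ∀ a : Op L, Sequent.OccursIn a t →
      ∃ b : Op L, Sequent.OccursIn b s ∧ a.IsSubterm b

end Calculus

end MultiType

namespace MultiType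

open Classical in
/-- The substitution that puts `x` at the places in `T`. -/
noncomputable def substOn {ι : Type*} {L : Language.{u}} (T : ι → Prop) (x : Str L) :
    ι → Option (Str L) :=
  fun o => if T o then some x else none

/-- The side of a sequent that is in position `q`. -/
def Position.root : Position → Place
  | .precedent => ⟨.left, []⟩
  | .succedent => ⟨.right, []⟩

variable {L : Language.{u}}

theorem substOn_eq_some {ι : Type*} {T : ι → Prop} {x z : Str L} {o : ι}
    (h : substOn T x o = some z) : T o ∧ z = x := by
  unfold substOn at h
  split_ifs at h with ho
  exact ⟨ho, (Option.some.inj h).symm⟩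

theorem substOn_congr {ι κ : Type*} {T : ι → Prop} {T' : κ → Prop} {x : Str L} {o : ι} {o' : κ}
    (h : T o ↔ T' o') : substOn T x o = substOn T' x o' := by
  by_cases ho : T o
  · rw [substOn, substOn, if_pos ho, if_pos (h.1 ho)]
  · rw [substOn, substOn, if_neg ho, if_neg (mt h.2 ho)]

/-! ### Subterms -/

theorem Op.IsSubterm.trans {a b c : Op L} (hab : a.IsSubterm b) (hbc : b.IsSubterm c) :
    a.IsSubterm c := by
  induction hbc with
  | refl => exact hab
  | arg c args i _ ih => exact .arg c args i ih

theorem Op.properSubterm_induction {P : Op L → Prop}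
    (h : ∀ a, (∀ b, b.IsProperSubterm a → P b) → P a) (a : Op L) : P a := by
  -- Structural induction speaks only of immediate arguments; the claim for all subterms reaches
  -- every proper subterm.
  suffices H : ∀ b, b.IsSubterm a → P b from H a (.refl a)
  induction a with
  | app c args ih =>
    have hprop : ∀ b, b.IsProperSubterm (.app c args) → P b := by
      rintro b ⟨hb, hne⟩
      cases hb with
      | refl => exact absurd rfl hne
      | arg _ _ i hi => exact ih i b hi
    intro b hb
    by_cases hne : b = .app c args
    · subst hne
      exact h _ hprop
    · exact hprop b ⟨hb, hne⟩

/-! ### Replacement -/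

theorem Str.replace_none (z : Str L) : z.replace (fun _ => none) = z := by
  induction z with
  | op a => rfl
  | node c args ih => simp [Str.replace, ih]

/-- Replacement stops at the topmost replaced node, so the second pass also runs through the
structures pasted by the first. If it leaves these unchanged, the two passes merge, with priority to
the first. -/
theorem Str.replace_replace (z : Str L) (σ τ : List ℕ → Option (Str L))
    (h : ∀ p w, σ p = some w → w.replace (fun q => τ (p ++ q)) = w) :
    (z.replace σ).replace τ = z.replace (fun p => (σ p).or (τ p)) := by
  induction z generalizing σ τ with
  | op a =>
    rcases hσ : σ [] with _ | w
    · simp [Str.replace, hσ]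
    · simpa [Str.replace, hσ] using h [] w hσ
  | node c args ih =>
    rcases hσ : σ [] with _ | w
    · simp only [Str.replace, hσ, Option.getD_none, Option.none_or]
      congr 2
      funext i
      exact ih i _ _ fun p w hp => h (i.val :: p) w hp
    · simpa [Str.replace, hσ] using h [] w hσ

/-- An operational term is a leaf, so no place of the original structure lies inside a pasted copy
of `x`. -/
theorem Str.sub_append_of_op {z : Str L} {p q : List ℕ} {a : Op L} (hp : z.sub p = some (.op a))
    {w : Str L} (hq : z.sub (p ++ q) = some w) : q = [] := by
  induction p generalizing z with
  | nil =>
    simp only [Str.sub, Option.some.injEq] at hp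
    subst hp
    cases q with
    | nil => rfl
    | cons => simp [Str.sub] at hq
  | cons i p ih =>
    cases z with
    | op b => simp [Str.sub] at hp
    | node c args =>
      simp only [Str.sub, List.cons_append] at hp hq
      split_ifs at hp hq
      exact ih hp hq

theorem Str.replace_substOn_insert {z : Str L} {x : Str L} {a : Op L} {T : List ℕ → Prop}
    {p₀ : List ℕ → Prop} (hT : ∀ p, T p → z.sub p = some (.op a) ∧ ¬ p₀ p)
    (hp₀ : ∀ p, p₀ p → ∃ w, z.sub p = some w) :
    (z.replace (substOn T x)).replace (substOn p₀ x) =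
      z.replace (substOn (fun p => T p ∨ p₀ p) x) := by
  rw [Str.replace_replace]
  · congr 1
    funext p
    by_cases h₁ : T p <;> by_cases h₂ : p₀ p <;> simp [substOn, h₁, h₂]
  · intro p w hp
    have hTp := (substOn_eq_some hp).1
    convert Str.replace_none w using 2
    funext q
    refine if_neg fun hq => ?_
    obtain ⟨v, hv⟩ := hp₀ _ hq
    have := Str.sub_append_of_op (hT p hTp).1 hv
    subst this
    exact (hT p hTp).2 (by simpa using hq)

theorem Sequent.replace_substOn_insert {s : Sequent L} {x : Str L} {a : Op L} {T : Place → Prop}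
    {o : Place} (hT : ∀ p, T p → s.sub p = some (.op a) ∧ p ≠ o)
    (ho : ∃ w, s.sub o = some w) :
    (s.replace (substOn T x)).replace (substOn (· = o) x) =
      s.replace (substOn (fun p => T p ∨ p = o) x) := by
  have hl := Str.replace_substOn_insert (z := s.left) (x := x) (a := a)
    (T := fun p => T ⟨.left, p⟩) (p₀ := fun p => ⟨.left, p⟩ = o)
    (fun p hp => hT _ hp) (by rintro p rfl; exact ho)
  have hr := Str.replace_substOn_insert (z := s.right) (x := x) (a := a)
    (T := fun p => T ⟨.right, p⟩) (p₀ := fun p => ⟨.right, p⟩ = o)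
    (fun p hp => hT _ hp) (by rintro p rfl; exact ho)
  exact congrArg₂ Sequent.mk hl hr

/-- Only leaves are replaced, so the connectives above an existing place, and with them its
position, are kept. -/
theorem Str.position_replace_substOn {z x w : Str L} {a : Op L} {T : List ℕ → Prop}
    (hT : ∀ p, T p → z.sub p = some (.op a)) {p : List ℕ} (hp : z.sub p = some w) (q : Position) :
    (z.replace (substOn T x)).position p q = z.position p q := by
  induction p generalizing z T q with
  | nil => simp [Str.position]
  | cons i p ih =>
    cases z with
    | op b => simp [Str.sub] at hp
    | node c args =>
      have hnil : ¬ T [] := fun h => by simpa [Str.sub] using hT [] h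
      simp only [Str.sub] at hp
      split_ifs at hp with hi
      have hT' : ∀ p, T (i :: p) → (args ⟨i, hi⟩).sub p = some (.op a) := fun p h => by
        simpa [Str.sub, hi] using hT _ h
      have := ih (T := fun p => T (i :: p)) hT' hp (if L.strNeg c ⟨i, hi⟩ then q.flip else q)
      simp only [Str.replace, substOn, if_neg hnil, Option.getD_none, Str.position, dif_pos hi]
      exact this

theorem Sequent.position_replace_substOn {s : Sequent L} {x w : Str L} {a : Op L}
    {T : Place → Prop} (hT : ∀ p, T p → s.sub p = some (.op a)) {o : Place}
    (ho : s.sub o = some w) : (s.replace (substOn T x)).position o = s.position o := by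
  obtain ⟨_ | _, p⟩ := o
  · exact Str.position_replace_substOn (T := fun p => T ⟨.left, p⟩) (fun p hp => hT _ hp) ho _
  · exact Str.position_replace_substOn (T := fun p => T ⟨.right, p⟩) (fun p hp => hT _ hp) ho _

theorem Sequent.replace_root_left (z y x : Str L) (a : Op L) (hz : z = .op a) :
    (Sequent.mk z y).replace (substOn (· = Position.precedent.root) x) = ⟨x, y⟩ := by
  subst hz
  have h : y.replace (fun _ => none) = y := Str.replace_none y
  simpa [Sequent.replace, Position.root, substOn, Str.replace] using h

theorem Sequent.replace_root_right (z y x : Str L) (a : Op L) (hz : z = .op a) :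
    (Sequent.mk y z).replace (substOn (· = Position.succedent.root) x) = ⟨y, x⟩ := by
  subst hz
  have h : y.replace (fun _ => none) = y := Str.replace_none y
  simpa [Sequent.replace, Position.root, substOn, Str.replace] using h

theorem Sequent.eq_root_of_path_nil {s : Sequent L} {o : Place} (h : o.path = []) :
    o = (s.position o).root := by
  obtain ⟨_ | _, p⟩ := o <;> obtain rfl : p = [] := h <;>
    simp [Sequent.position, Str.position, Position.root]

/-! ### Cut-free derivability -/

/-- `C.CutFreeDerivable s`: the sequent `s` is derivable without cut. -/
inductive Calculus.CutFreeDerivable (C : Calculus L) : Sequent L → Prop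
  | rule {r : C.Rule} {n : ℕ} {I : Inference L n} {A : Analysis n} (h : C.app r I A)
      (d : ∀ i, C.CutFreeDerivable (I.prem i)) : C.CutFreeDerivable I.concl

namespace Calculus

variable {C : Calculus L}

theorem CutFreeDerivable.exists_derivation {s : Sequent L} (h : C.CutFreeDerivable s) :
    ∃ d : Derivation C ∅ s, d.CutFree := by
  induction h with
  | rule h _ ih =>
    choose d hd using ih
    exact ⟨.rule h d, hd⟩

theorem CutFreeDerivable.derivable {s : Sequent L} (h : C.CutFreeDerivable s) : C.Derivable s :=
  let ⟨d, _⟩ := h.exists_derivation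
  ⟨d⟩

theorem CutFreeDerivable.wf {s : Sequent L} (h : C.CutFreeDerivable s) : s.WF := by
  cases h with
  | rule h _ => exact C.app_wf h none

theorem IsAxiom.cutFreeDerivable {s : Sequent L} (h : C.IsAxiom s) : C.CutFreeDerivable s := by
  obtain ⟨r, I, A, h, rfl⟩ := h
  exact .rule h fun i => i.elim0

/-- Substitution of `x` for the parametric occurrences of `a` in a congruence-closed set. -/
theorem ClosedUnderSubst.substOn {q : Position} (hq : C.ClosedUnderSubst q) {r : C.Rule} {n : ℕ}
    {I : Inference L n} {A : Analysis n} (h : C.app r I A) {x : Str L} {a : Op L} (hx : x.WF)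
    (hxa : x.type = a.type) {T : InfPlace n → Prop}
    (hT : ∀ o, T o → I.sub o = some (.op a) ∧ A.IsParam o ∧ I.position o = q)
    (hcl : ∀ o o', A.Congr o o' → T o → T o') :
    ∃ A' : Analysis n, C.app r (I.replace (substOn T x)) A' ∧
      ∀ (o : Place) (b : Op L),
        PrincipalAt I A o b → PrincipalAt (I.replace (MultiType.substOn T x)) A' o b := by
  refine hq r n I A h _ ?_ ?_
  · intro o z hz
    obtain ⟨ho, rfl⟩ := substOn_eq_some hz
    exact ⟨a, (hT o ho).1, (hT o ho).2.1, (hT o ho).2.2, hx, hxa⟩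
  · intro o o' hoo
    exact substOn_congr ⟨hcl _ _ hoo, hcl _ _ (A.symm hoo)⟩

/-! ### Substitution along congruence in cut-free derivations -/

section Parametric

-- The principal case is abstracted as `hprin`, so that one argument serves both premises of a cut.
-- `hnt` makes C3' available for parameters of the form `a`.
variable (hC : C.IsDisplayCalculus) (hAx : C.AxiomPrincipalUnique) (h2 : C.C2) (h3' : C.C3')
  (h4 : C.C4) (h5' : C.C5') (h5'' : C.C5'') {q : Position} (hq : C.ClosedUnderSubst q)
  {x : Str L} {a : Op L} (hx : x.WF) (hxa : x.type = a.type) (hnt : ¬ C.OnlyTrivialCuts a.type)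
  (hprin : ∀ (r : C.Rule) (n : ℕ) (I : Inference L n) (A : Analysis n), C.app r I A →
    (∀ i, C.CutFreeDerivable (I.prem i)) → PrincipalAt I A q.root a →
      C.CutFreeDerivable (I.concl.replace (substOn (· = q.root) x)))

include h2 h3' h4 hq hx hxa hnt in
/-- Substitution of `x` for the whole congruence classes of a set of parametric occurrences of `a`
in the conclusion. -/
theorem exists_app_replace_congruent {r : C.Rule} {n : ℕ} {I : Inference L n} {A : Analysis n}
    (h : C.app r I A) {S : Place → Prop}
    (hS : ∀ o, S o → I.concl.sub o = some (.op a) ∧ I.concl.position o = q) :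
    ∃ (A' : Analysis n) (I' : Inference L n), C.app r I' A' ∧
      (∀ i, I'.prem i = (I.prem i).replace
        (substOn (fun o' => ∃ o, S o ∧ A.Congr (none, o) (some i, o')) x)) ∧
      I'.concl = I.concl.replace (substOn (fun o => S o ∧ A.IsParam (none, o)) x) ∧
      ∀ (o : Place) (b : Op L), PrincipalAt I A o b → PrincipalAt I' A' o b := by
  obtain ⟨A', hA', hP⟩ := hq.substOn h hx hxa (T := fun o' => ∃ o, S o ∧ A.Congr (none, o) o')
    (by
      rintro o' ⟨o, ho, hoo⟩
      exact ⟨(h2 _ _ _ _ h _ _ hoo).symm.trans (hS o ho).1, A.trans (A.symm hoo) hoo,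
        (h4 _ _ _ _ h _ _ hoo).symm.trans (hS o ho).2⟩)
    (by
      rintro o₁ o₂ h₁₂ ⟨o, ho, hoo⟩
      exact ⟨o, ho, A.trans hoo h₁₂⟩)
  refine ⟨A', _, hA', fun i => rfl, ?_, hP⟩
  refine congrArg (fun σ => I.concl.replace σ) (funext fun o' => substOn_congr ?_)
  constructor
  · rintro ⟨o, ho, hoo⟩
    have hpar : A.Congr (none, o) (none, o) := A.trans hoo (A.symm hoo)
    -- By C3' the congruence class meets the conclusion only at `o`: no occurrence outside `S` is
    -- changed there.
    obtain rfl : o = o' := h3' _ _ _ _ h (none, o) (.op a) (hS o ho).1 hnt o o' hpar hoo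
    exact ⟨ho, hoo⟩
  · rintro ⟨ho, hpar⟩
    exact ⟨o', ho, hpar⟩

include hC h2 h3' h4 h5'' hq hx hxa hnt hprin in
/-- An occurrence of `a` in an axiom is replaced by `x` after being displayed; the display rules are
then applied backwards. -/
theorem IsAxiom.cutFreeDerivable_replace {s : Sequent L} (hs : C.IsAxiom s) {o : Place}
    (ho : s.sub o = some (.op a)) (hpos : s.position o = q) :
    C.CutFreeDerivable (s.replace (substOn (· = o) x)) := by
  obtain ⟨s', o', hsteps, hpath⟩ := hC.display s o _ hs.cutFreeDerivable.derivable ho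
  suffices H : ∀ t : Sequent L × Place, Relation.ReflTransGen C.DisplayStep t (s', o') →
      C.IsAxiom t.1 → t.1.sub t.2 = some (.op a) → t.1.position t.2 = q →
        C.CutFreeDerivable (t.1.replace (substOn (· = t.2) x)) from H _ hsteps hs ho hpos
  intro t ht
  induction ht using Relation.ReflTransGen.head_induction_on with
  | refl =>
    rintro ⟨r, I, A, h, hI⟩ ho hpos
    obtain rfl : o' = q.root := hpos ▸ Sequent.eq_root_of_path_nil hpath
    simp only at hI ho hpos
    subst hI
    by_cases hpar : A.IsParam (none, q.root)
    · obtain ⟨A', I', hA', -, hI', -⟩ := exists_app_replace_congruent h2 h3' h4 hq hx hxa hnt h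
        (S := (· = q.root)) (by rintro _ rfl; exact ⟨ho, hpos⟩)
      have := CutFreeDerivable.rule hA' fun i => i.elim0
      rw [hI'] at this
      convert this using 3
      funext p
      exact propext ⟨fun hp => ⟨hp, hp ▸ hpar⟩, And.left⟩
    · exact hprin r 0 I A h (fun i => i.elim0) ⟨ho, hpar⟩
  | head hstep _ ih =>
    rename_i t t₁ _
    intro hax ho hpos
    obtain ⟨r, I, A, hr, h, hprem, hconcl, hcongr⟩ := hstep
    -- Display steps keep the sequent an axiom, so the displayed end has a premise-free rule
    -- application to analyse.
    have hax₁ : C.IsAxiom t₁.1 := hconcl ▸ h5'' r I A hr h (hprem ▸ hax)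
    have hsub : (I.prem 0).sub t.2 = I.concl.sub t₁.2 := h2 _ _ _ _ h _ _ hcongr
    have hpos' : (I.prem 0).position t.2 = I.concl.position t₁.2 := h4 _ _ _ _ h _ _ hcongr
    rw [hprem, hconcl] at hsub hpos'
    have hcf := ih hax₁ (hsub ▸ ho) (hpos' ▸ hpos)
    -- The inverse step has the same congruence, so substitution in it leads from the replaced `t₁`
    -- back to the replaced `t`.
    obtain ⟨r', -, hinv⟩ := hC.invertible r I A hr h
    obtain ⟨A', I', hA', hI'prem, hI', -⟩ := exists_app_replace_congruent h2 h3' h4 hq hx hxa hnt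
      hinv (S := (· = t.2)) (by
        rintro _ rfl
        exact ⟨(congrArg (fun u => u.sub t.2) hprem).trans ho,
          (congrArg (fun u => u.position t.2) hprem).trans hpos⟩)
    have key : C.CutFreeDerivable I'.concl := by
      refine .rule hA' fun i => ?_
      rw [hI'prem i]
      change C.CutFreeDerivable (I.concl.replace _)
      rw [hconcl]
      convert hcf using 3
      funext p
      apply propext
      constructor
      · rintro ⟨_, rfl, hp⟩
        -- C3' for the forward step: the place in `t` has no congruent place in `t₁` other than the
        -- traced one.
        exact h3' _ _ _ _ h (some 0, t.2) (.op a)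
          ((congrArg (fun u => u.sub t.2) hprem).trans ho) hnt p t₁.2 hp hcongr
      · rintro rfl
        exact ⟨t.2, rfl, hcongr⟩
    rw [hI'] at key
    change C.CutFreeDerivable ((I.prem 0).replace _) at key
    rw [hprem] at key
    convert key using 3
    funext p
    refine propext ⟨fun hp => ⟨hp, ?_⟩, And.left⟩
    subst hp
    exact A.trans hcongr (A.symm hcongr)

include hC hAx h2 h3' h4 h5' h5'' hq hx hxa hnt hprin in
/-- If `x` can be put for principal displayed occurrences of `a` in position `q`, then it can be put
for any set of occurrences of `a` in position `q`. -/
theorem CutFreeDerivable.replace {s : Sequent L} (hs : C.CutFreeDerivable s) (S : Place → Prop)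
    (hS : ∀ o, S o → s.sub o = some (.op a) ∧ s.position o = q) :
    C.CutFreeDerivable (s.replace (substOn S x)) := by
  induction hs generalizing S with
  | @rule r n I A h d ih =>
    obtain ⟨A', I', hA', hI'prem, hI', hP⟩ :=
      exists_app_replace_congruent h2 h3' h4 hq hx hxa hnt h hS
    have hcf : ∀ i, C.CutFreeDerivable (I'.prem i) := by
      intro i
      rw [hI'prem i]
      -- Sets of occurrences are needed here: one parameter of the conclusion may be congruent to
      -- several in a premise, as in contraction.
      apply ih
      rintro o' ⟨o, ho, hoo⟩
      exact ⟨(h2 _ _ _ _ h _ _ hoo).symm.trans (hS o ho).1,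
        (h4 _ _ _ _ h _ _ hoo).symm.trans (hS o ho).2⟩
    by_cases hall : ∀ o, S o → A.IsParam (none, o)
    · have := CutFreeDerivable.rule hA' hcf
      rw [hI'] at this
      convert this using 3
      funext p
      exact propext ⟨fun hp => ⟨hp, hall p hp⟩, And.left⟩
    · push Not at hall
      obtain ⟨o, ho, hnp⟩ := hall
      have hroot : ∀ p, S p → ¬ A.IsParam (none, p) → p = q.root ∨ n = 0 := by
        intro p hp hpn
        refine (h5' r n I A h (fun i => (d i).derivable) p a ⟨(hS p hp).1, hpn⟩).imp_left ?_
        intro hpath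
        rw [← (hS p hp).2]
        exact Sequent.eq_root_of_path_nil hpath
      -- At most one chosen occurrence is principal: in an axiom by `hAx`, otherwise because it must
      -- be the whole side in position `q`.
      have huniq : ∀ p, S p → ¬ A.IsParam (none, p) → p = o := by
        intro p hp hpn
        rcases Nat.eq_zero_or_pos n with hn | hn
        · subst hn
          exact hAx r I A h p o a ⟨(hS p hp).1, hpn⟩ ⟨(hS o ho).1, hnp⟩
            ((hS p hp).2.trans (hS o ho).2.symm)
        · rw [(hroot p hp hpn).resolve_right hn.ne', (hroot o ho hnp).resolve_right hn.ne']
      -- The parametric occurrences are replaced first; the one at `o` stays principal in `I'` and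
      -- is replaced separately.
      have hsplit : I'.concl.replace (substOn (· = o) x) = I.concl.replace (substOn S x) := by
        rw [hI', Sequent.replace_substOn_insert (a := a)
          (fun p (hp : S p ∧ A.IsParam (none, p)) =>
            ⟨(hS p hp.1).1, by rintro rfl; exact hnp hp.2⟩) ⟨_, (hS o ho).1⟩]
        congr 2
        funext p
        apply propext
        constructor
        · rintro (hp | rfl)
          exacts [hp.1, ho]
        · intro hp
          by_cases hpn : A.IsParam (none, p)
          exacts [.inl ⟨hp, hpn⟩, .inr (huniq p hp hpn)]
      rw [← hsplit]
      have hprin' := hP o a ⟨(hS o ho).1, hnp⟩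
      have hdisp : o = q.root → C.CutFreeDerivable (I'.concl.replace (substOn (· = o) x)) := by
        rintro rfl
        exact hprin r n I' A' hA' hcf hprin'
      rcases hroot o ho hnp with hroot | hn
      · exact hdisp hroot
      · subst hn
        by_cases hor : o = q.root
        · exact hdisp hor
        · refine IsAxiom.cutFreeDerivable_replace hC h2 h3' h4 h5'' hq hx hxa hnt hprin
            ⟨r, I', A', hA', rfl⟩ hprin'.1 ?_
          rw [hI', Sequent.position_replace_substOn (fun p hp => (hS p hp.1).1) (hS o ho).1]
          exact (hS o ho).2

end Parametric

/-! ### Elimination of a cut by induction on the cut term -/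

section CutElimination

variable (hC : C.IsDisplayCalculus) (hAx : C.AxiomPrincipalUnique) (h2 : C.C2) (h3' : C.C3')
  (h4 : C.C4) (h5' : C.C5') (h5'' : C.C5'') (h6' : C.C6') (h7' : C.C7') (h8' : C.C8') (h9 : C.C9)
  (h10 : C.C10)

/-- Serves both for the derivations given by C8', with the premises of the two inferences as
assumptions, and for removing all cuts of an arbitrary derivation. -/
theorem cutFreeDerivable_of_derivation {H : Set (Sequent L)} {P : Str L → Op L → Str L → Prop}
    (hH : ∀ s ∈ H, C.CutFreeDerivable s)
    (hcut : ∀ x a y, P x a y → C.Cut x a y → C.CutFreeDerivable ⟨x, .op a⟩ →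
      C.CutFreeDerivable ⟨.op a, y⟩ → C.CutFreeDerivable ⟨x, y⟩)
    {s : Sequent L} (d : Derivation C H s) (hd : d.AllCuts P) : C.CutFreeDerivable s := by
  induction d with
  | hyp h => exact hH _ h
  | rule h _ ih => exact .rule h fun i => ih i (hd i)
  | cut h _ _ ih₁ ih₂ => exact hcut _ _ _ hd.1 h (ih₁ hd.2.1) (ih₂ hd.2.2)

include hC hAx h2 h3' h4 h5' h5'' h6' h7' h8' h9 h10 in
theorem CutFreeDerivable.cut (a : Op L) : ∀ x y : Str L, C.Cut x a y →
    C.CutFreeDerivable ⟨x, .op a⟩ → C.CutFreeDerivable ⟨.op a, y⟩ → C.CutFreeDerivable ⟨x, y⟩ := by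
  induction a using Op.properSubterm_induction with
  | h a ih =>
    intro x y hcut hx hy
    by_cases hnt : C.OnlyTrivialCuts a.type
    · rcases hnt x a y rfl hcut hx.derivable hy.derivable with rfl | rfl
      exacts [hy, hx]
    -- `x ⊢ y` is read as `x ⊢ a` with the succedent `a` replaced by `y`.
    rw [← Sequent.replace_root_right (.op a) x y a rfl]
    refine CutFreeDerivable.replace hC hAx h2 h3' h4 h5' h5'' h6' (C.cut_wf hcut).2.2
      (h10 _ _ _ hcut).2 hnt ?_ hx _ (by rintro _ rfl; exact ⟨rfl, rfl⟩)
    intro r₁ n₁ I₁ A₁ hr₁ hd₁ hp₁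
    obtain ⟨x', a₁, hI₁⟩ : ∃ x' z, I₁.concl = ⟨x', z⟩ := ⟨_, _, rfl⟩
    have hsub₁ : a₁ = .op a := by
      have := hp₁.1
      rw [hI₁] at this
      simpa [Sequent.sub, Position.root, Str.sub] using this
    rw [hI₁, Sequent.replace_root_right _ _ _ a hsub₁]
    subst hsub₁
    have hx' : C.CutFreeDerivable ⟨x', .op a⟩ := hI₁ ▸ CutFreeDerivable.rule hr₁ hd₁
    have hx'a : x'.type = a.type := h9 _ hx'.derivable
    -- Second tracing: `x' ⊢ y` is `a ⊢ y` with the precedent `a` replaced by `x'`, the left side at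
    -- which the first tracing stopped.
    rw [← Sequent.replace_root_left (.op a) y x' a rfl]
    refine CutFreeDerivable.replace hC hAx h2 h3' h4 h5' h5'' h7' hx'.wf.1
      hx'a hnt ?_ hy _ (by rintro _ rfl; exact ⟨rfl, rfl⟩)
    intro r₂ n₂ I₂ A₂ hr₂ hd₂ hp₂
    obtain ⟨a₂, y', hI₂⟩ : ∃ z y', I₂.concl = ⟨z, y'⟩ := ⟨_, _, rfl⟩
    have hsub₂ : a₂ = .op a := by
      have := hp₂.1
      rw [hI₂] at this
      simpa [Sequent.sub, Position.root, Str.sub] using this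
    rw [hI₂, Sequent.replace_root_left _ _ _ a hsub₂]
    subst hsub₂
    have hy' : C.CutFreeDerivable ⟨.op a, y'⟩ := hI₂ ▸ CutFreeDerivable.rule hr₂ hd₂
    obtain ⟨d, hd⟩ := h8' r₁ r₂ n₁ n₂ I₁ I₂ A₁ A₂ x' a y' hr₁ hr₂ (fun i => (hd₁ i).derivable)
      (fun i => (hd₂ i).derivable) hI₁ hI₂ hp₁ hp₂
      -- The original cut concerned `x` and `y`; that `x'` and `y'` may also be cut on `a` follows
      -- from C9, which gives them the type of `a`.
      (C.cut_of_type hx'.wf.1 hx'.wf.2 hy'.wf.2 hx'a (h9 _ hy'.derivable).symm)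
    refine cutFreeDerivable_of_derivation ?_ (fun x b y hb => ih b hb.1 x y) d hd
    rintro s (⟨i, rfl⟩ | ⟨i, rfl⟩)
    exacts [hd₁ i, hd₂ i]

end CutElimination

/-! ### The subformula property -/

theorem C1.isSubterm_of_contains (h1 : C.C1) {s : Sequent L} (d : Derivation C ∅ s)
    (hd : d.CutFree) {t : Sequent L} (ht : d.Contains t) {a : Op L} (ha : Sequent.OccursIn a t) :
    ∃ b : Op L, Sequent.OccursIn b s ∧ a.IsSubterm b := by
  induction d with
  | hyp h => exact h.elim
  | @rule r n I A h d ih =>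
    rcases ht with rfl | ⟨i, hi⟩
    · exact ⟨a, ha, .refl a⟩
    · obtain ⟨b, hb, hab⟩ := ih i (hd i) hi
      obtain ⟨c, hc, hbc⟩ := h1 _ _ _ _ h i b hb
      exact ⟨c, hc, hab.trans hbc⟩
  | cut => exact hd.1.elim

end Calculus

end MultiType

theorem theorem3p1 (L : MultiType.Language.{u}) (C : MultiType.Calculus L)
    (hC : C.IsDisplayCalculus) (hAx : C.AxiomPrincipalUnique)
    (h2 : C.C2) (h2' : C.C2') (h3' : C.C3') (h4 : C.C4) (h5' : C.C5') (h5'' : C.C5'')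
    (h6' : C.C6') (h7' : C.C7') (h8' : C.C8') (h8'' : C.C8'') (h9 : C.C9) (h10 : C.C10) :
    C.CutAdmissible ∧ (C.C1 → C.SubformulaProperty) := by
  have hca : C.CutAdmissible := by
    rintro s ⟨d⟩
    refine (MultiType.Calculus.cutFreeDerivable_of_derivation (P := C.Cut) (by simp)
      (fun x a y _ => MultiType.Calculus.CutFreeDerivable.cut hC hAx h2 h3' h4 h5' h5'' h6' h7' h8'
        h9 h10 a x y) d ?_).exists_derivation
    -- With `P := C.Cut` the requirement on the cuts is met by every derivation.
    induction d with
    | hyp h => exact h.elim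
    | rule _ _ ih => exact ih
    | cut h _ _ ih₁ ih₂ => exact ⟨h, ih₁, ih₂⟩
  refine ⟨hca, fun h1 s hs => ?_⟩
  obtain ⟨d, hd⟩ := hca s hs
  exact ⟨d, hd, fun t ht a ha => h1.isSubterm_of_contains d hd ht ha⟩
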